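/- All spaces are Hausdorff. A subset of a topological space is $F_\sigma$ if it is a countable union of closed sets, and a topological space is a $Q$-space if each of its subsets is $F_\sigma$ in it; a set $A\subseteq\mathbb R$ is a $Q$-set if $A$, with the subspace topology, is a $Q$-space. For a space $X$ let $C_p(X)$ be the linear space of all continuous functions $X\to\mathbb R$ with the topology of pointwise convergence. A space $Y$ is $l$-dominated by a space $X$ if there is a continuous linear surjection from $C_p(X)$ onto $C_p(Y)$. Theorem. Let $X$ and $Y$ be normal spaces such that $Y$ is $l$-dominated by $X$. If $X$ is a $Q$-space, then $Y$ is a $Q$-space. Consequently, if $X$ and $Y$ are metrizable spaces such that $Y$ is $l$-dominated by $X$, and $X$ is a $Q$-space, then $Y$ is a $Q$-space; in particular, if $A,B\subseteq\mathbb R$, $B$ is $l$-dominated by $A$, and $A$ is a $Q$-set, then $B$ is a $Q$-set. -/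

import Mathlib

universe u v

/-- A subset of a topological space is `F_σ` if it is a countable union of closed sets. -/
def IsFSigma {X : Type*} [TopologicalSpace X] (A : Set X) : Prop :=
  ∃ F : ℕ → Set X, (∀ n, IsClosed (F n)) ∧ A = ⋃ n, F n

/-- A topological space is a `Q`-space if each of its subsets is `F_σ`. A set `A` of reals is a
`Q`-set precisely when the subspace `A` is a `Q`-space. -/
def IsQSpace (X : Type*) [TopologicalSpace X] : Prop :=
  ∀ A : Set X, IsFSigma A

/-- `Cp X`: the linear space of continuous real-valued functions on `X`, as a subspace of `X → ℝ`.
The topology it carries is the one induced by the product topology of `X → ℝ`, that is, the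
topology of pointwise convergence. -/
def Cp (X : Type*) [TopologicalSpace X] : Submodule ℝ (X → ℝ) where
  carrier := {f | Continuous f}
  zero_mem' := continuous_zero
  add_mem' := fun hf hg => Continuous.add hf hg
  smul_mem' := fun c _ hf => Continuous.const_smul hf c

/-- `LDominated Y X`: the space `Y` is `l`-dominated by the space `X`, i.e. there is a continuous
linear map of `Cp X` onto `Cp Y`. -/
def LDominated (Y X : Type*) [TopologicalSpace Y] [TopologicalSpace X] : Prop :=
  ∃ T : Cp X →L[ℝ] Cp Y, Function.Surjective T

/-! A normal space is a `Q`-space iff every real function on it is of the first Baire class, and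
this property transfers along a continuous linear surjection `T`. Dualizing, the functionals `eval y
∘ T` are linearly independent, so any `g` on `Y` has the form `y ↦ ψ (eval y ∘ T)` with `ψ` linear
on the algebraic dual of `Cp X`. If continuous `w n` converge pointwise to `x ↦ ψ (eval x)`, then `T
(w n)` converges pointwise to `g`, because each `eval y ∘ T` is a finite combination of evaluations
on `X`. -/

open Filter Topology in
/-- A function is of the first Baire class if it is the pointwise limit of a sequence of continuous
functions. -/
def IsBaireOne {X : Type*} [TopologicalSpace X] (f : X → ℝ) : Prop :=
  ∃ u : ℕ → X → ℝ, (∀ n, Continuous (u n)) ∧ ∀ x, Tendsto (fun n => u n x) atTop (𝓝 (f x))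

section BaireOne

open Filter Topology

variable {X : Type*} [TopologicalSpace X]

theorem IsFSigma.exists_monotone {A : Set X} (hA : IsFSigma A) :
    ∃ F : ℕ → Set X, Monotone F ∧ (∀ n, IsClosed (F n)) ∧ A = ⋃ n, F n := by
  obtain ⟨F, hF, rfl⟩ := hA
  refine ⟨Set.accumulate F, Set.monotone_accumulate, fun n => ?_, Set.iUnion_accumulate.symm⟩
  exact (Set.finite_Iic n).isClosed_biUnion fun i _ => hF i

/-- In a normal space, the indicator function of a set that is both `F_σ` and `G_δ` is the
pointwise limit of continuous functions with values in `[0, 1]`. -/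
theorem IsFSigma.exists_tendsto_indicator [NormalSpace X] {A : Set X} (hA : IsFSigma A)
    (hAc : IsFSigma Aᶜ) :
    ∃ u : ℕ → X → ℝ, (∀ n, Continuous (u n)) ∧ (∀ n x, u n x ∈ Set.Icc (0 : ℝ) 1) ∧
      ∀ x, Tendsto (fun n => u n x) atTop (𝓝 (A.indicator 1 x)) := by
  obtain ⟨F, hFm, hFc, hF⟩ := hA.exists_monotone
  obtain ⟨H, hHm, hHc, hH⟩ := hAc.exists_monotone
  have hd : ∀ n, Disjoint (H n) (F n) := fun n =>
    (disjoint_compl_left (a := A)).mono (hH ▸ Set.subset_iUnion H n) (hF ▸ Set.subset_iUnion F n)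
  choose u hu0 hu1 hu using fun n => exists_continuous_zero_one_of_isClosed (hHc n) (hFc n) (hd n)
  refine ⟨fun n => u n, fun n => (u n).continuous, hu, fun x => ?_⟩
  by_cases hx : x ∈ A
  · obtain ⟨m, hm⟩ := Set.mem_iUnion.1 (hF ▸ hx)
    refine tendsto_const_nhds.congr' ?_
    filter_upwards [eventually_ge_atTop m] with n hn
    simp [hx, hu1 n (hFm hn hm)]
  · obtain ⟨m, hm⟩ := Set.mem_iUnion.1 (hH ▸ (show x ∈ Aᶜ from hx))
    refine tendsto_const_nhds.congr' ?_
    filter_upwards [eventually_ge_atTop m] with n hn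
    simp [hx, hu0 n (hHm hn hm)]

/-- Each binary digit of `f` is an indicator function, hence a limit of continuous functions into
`[0, 1]`; the weights `2⁻⁽ⁱ⁺¹⁾` dominate the series, so sum and limit commute. -/
theorem IsQSpace.isBaireOne_of_mem_Ico [NormalSpace X] (hX : IsQSpace X) {f : X → ℝ}
    (hf : ∀ x, f x ∈ Set.Ico (0 : ℝ) 1) : IsBaireOne f := by
  let A : ℕ → Set X := fun i => {x | Real.digits (f x) 2 i = 1}
  choose u huc huI hu using fun i =>
    IsFSigma.exists_tendsto_indicator (hX (A i)) (hX (A i)ᶜ)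
  have hs : Summable fun i : ℕ => ((2 : ℝ) ^ (i + 1))⁻¹ := by
    simpa [pow_succ] using summable_geometric_two.mul_left (2⁻¹ : ℝ)
  have hbound : ∀ i n x, ‖u i n x * ((2 : ℝ) ^ (i + 1))⁻¹‖ ≤ ((2 : ℝ) ^ (i + 1))⁻¹ := by
    intro i n x
    have h := huI i n x
    rw [Real.norm_of_nonneg (mul_nonneg h.1 (by positivity))]
    exact mul_le_of_le_one_left (by positivity) h.2
  refine ⟨fun n x => ∑' i, u i n x * ((2 : ℝ) ^ (i + 1))⁻¹, fun n => ?_, fun x => ?_⟩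
  · exact continuous_tsum (fun i => (huc i n).mul_const _) hs fun i x => hbound i n x
  · have hfx : f x = ∑' i, (A i).indicator 1 x * ((2 : ℝ) ^ (i + 1))⁻¹ := by
      rw [← Real.ofDigits_digits one_lt_two (hf x), Real.ofDigits]
      refine tsum_congr fun i => ?_
      by_cases hx : Real.digits (f x) 2 i = 1
      · simp [Real.ofDigitsTerm, A, hx]
      · have h0 : Real.digits (f x) 2 i = 0 := by omega
        simp [Real.ofDigitsTerm, A, h0]
    rw [hfx]
    exact tendsto_tsum_of_dominated_convergence hs (fun i => (hu i x).mul_const _)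
      (Eventually.of_forall fun n i => hbound i n x)

/-- On a normal `Q`-space every real function is of the first Baire class. -/
theorem IsQSpace.isBaireOne [NormalSpace X] (hX : IsQSpace X) (f : X → ℝ) : IsBaireOne f := by
  have hπ := Real.pi_pos
  have hmem : ∀ x, Real.arctan (f x) / Real.pi + 1 / 2 ∈ Set.Ioo (0 : ℝ) 1 := by
    intro x
    have h1 : -(1 / 2) < Real.arctan (f x) / Real.pi := by
      rw [lt_div_iff₀ hπ]; linarith [Real.neg_pi_div_two_lt_arctan (f x)]
    have h2 : Real.arctan (f x) / Real.pi < 1 / 2 := by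
      rw [div_lt_iff₀ hπ]; linarith [Real.arctan_lt_pi_div_two (f x)]
    constructor <;> linarith
  obtain ⟨u, huc, hu⟩ := hX.isBaireOne_of_mem_Ico fun x => Set.Ioo_subset_Ico_self (hmem x)
  -- Clamping to `[δ n, 1 - δ n]` keeps the approximants off the endpoints, where the tangent that
  -- undoes the rescaled `arctan` blows up.
  let δ : ℕ → ℝ := fun n => 1 / ((n : ℝ) + 1) / 2
  have hδ0 : ∀ n, 0 < δ n := fun n => by positivity
  have hδ1 : ∀ n, δ n ≤ 1 / 2 := fun n => by
    have : 1 / ((n : ℝ) + 1) ≤ 1 := by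
      rw [div_le_one (by positivity)]; linarith [n.cast_nonneg (α := ℝ)]
    simp only [δ]; linarith
  have hδ : Tendsto δ atTop (𝓝 0) := by
    simpa [δ] using (tendsto_one_div_add_atTop_nhds_zero_nat (𝕜 := ℝ)).div_const 2
  let v : ℕ → X → ℝ := fun n x => max (δ n) (min (u n x) (1 - δ n))
  have hcos : ∀ t ∈ Set.Ioo (0 : ℝ) 1, Real.cos (Real.pi * (t - 1 / 2)) ≠ 0 := fun t ht =>
    (Real.cos_pos_of_mem_Ioo ⟨by nlinarith [ht.1], by nlinarith [ht.2]⟩).ne'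
  have hv : ∀ n x, v n x ∈ Set.Ioo (0 : ℝ) 1 := fun n x =>
    ⟨lt_max_of_lt_left (hδ0 n), max_lt (by linarith [hδ1 n])
      ((min_le_right _ _).trans_lt (by linarith [hδ0 n]))⟩
  have hvc : ∀ n, Continuous (v n) := fun n =>
    continuous_const.max ((huc n).min continuous_const)
  refine ⟨fun n x => Real.tan (Real.pi * (v n x - 1 / 2)), fun n => ?_, fun x => ?_⟩
  · refine continuous_iff_continuousAt.2 fun x => ?_
    exact ContinuousAt.comp (f := fun x => Real.pi * (v n x - 1 / 2))
      (Real.continuousAt_tan.2 (hcos _ (hv n x)))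
      (continuous_const.mul ((hvc n).sub continuous_const)).continuousAt
  · have hlim : Tendsto (fun n => v n x) atTop (𝓝 (Real.arctan (f x) / Real.pi + 1 / 2)) := by
      have h := hδ.max ((hu x).min (hδ.const_sub 1))
      rwa [sub_zero, min_eq_left (hmem x).2.le, max_eq_right (hmem x).1.le] at h
    have h := (Real.continuousAt_tan.2 (hcos _ (hmem x))).tendsto.comp
      ((hlim.sub_const (1 / 2)).const_mul Real.pi)
    have he : Real.pi * (Real.arctan (f x) / Real.pi + 1 / 2 - 1 / 2) = Real.arctan (f x) := by
      field_simp; ring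
    rwa [he, Real.tan_arctan] at h

/-- A space on which every real function is of the first Baire class is a `Q`-space. -/
theorem IsQSpace.of_forall_isBaireOne (h : ∀ f : X → ℝ, IsBaireOne f) : IsQSpace X := by
  intro A
  obtain ⟨u, huc, hu⟩ := h (A.indicator 1)
  refine ⟨fun m => ⋂ n ≥ m, {x | 1 / 2 ≤ u n x}, fun m => ?_, Set.ext fun x => ?_⟩
  · exact isClosed_biInter fun n _ => isClosed_le continuous_const (huc n)
  · simp only [Set.mem_iUnion, Set.mem_iInter, Set.mem_ofPred_eq]
    rw [← eventually_atTop (p := fun n => 1 / 2 ≤ u n x)]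
    constructor
    · intro hx
      have hux := hu x
      rw [Set.indicator_of_mem hx] at hux
      exact (hux.eventually_const_lt (by norm_num)).mono fun n hn => hn.le
    · intro hev
      by_contra hx
      have hux := hu x
      rw [Set.indicator_of_notMem hx] at hux
      have := ge_of_tendsto hux hev
      norm_num at this

end BaireOne

section Dual

open Filter Topology

variable {X Y : Type*} [TopologicalSpace X] [TopologicalSpace Y]

namespace Cp

/-- Evaluation at a point as a linear functional on `Cp X`. -/
def eval (x : X) : Cp X →ₗ[ℝ] ℝ :=
  (LinearMap.proj x).comp (Cp X).subtype

@[simp]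
theorem eval_apply (x : X) (f : Cp X) : eval x f = (f : X → ℝ) x :=
  rfl

theorem continuous_eval (x : X) : Continuous (eval x) :=
  (continuous_apply x).comp continuous_subtype_val

/-- The continuous linear functionals on `Cp X` are the linear combinations of evaluations. -/
theorem mem_span_eval {φ : Cp X →ₗ[ℝ] ℝ} (hφ : Continuous φ) :
    φ ∈ Submodule.span ℝ (Set.range (eval (X := X))) := by
  -- The topology of `Cp X` is the coarsest one making all evaluations continuous.
  rw [LinearMap.mem_span_iff_continuous]
  convert hφ
  rw [instTopologicalSpaceSubtype, Pi.topologicalSpace, induced_iInf]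
  exact iInf_congr fun x =>
    (induced_compose (f := Subtype.val) (g := fun f : X → ℝ => f x)).symm

theorem linearIndependent_eval [T4Space Y] : LinearIndependent ℝ (eval (X := Y)) := by
  classical
  rw [linearIndependent_iff']
  intro s c hc y hy
  obtain ⟨h, h0, h1, -⟩ := exists_continuous_zero_one_of_isClosed
    (s.erase y).finite_toSet.isClosed (isClosed_singleton (x := y)) (by simp)
  have := LinearMap.congr_fun hc (⟨h, h.continuous⟩ : Cp Y)
  rw [LinearMap.sum_apply, Finset.sum_eq_single_of_mem y hy] at this
  · simpa [h1 rfl] using this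
  · intro z hz hzy
    have : h z = 0 := h0 (by simp [hz, hzy])
    simp [this]

end Cp

/-- If `Y` is `l`-dominated by `X` and all real functions on `X` are of the first Baire class, then
so are all real functions on `Y`. -/
theorem LDominated.isBaireOne [T4Space Y] (h : LDominated Y X)
    (hX : ∀ f : X → ℝ, IsBaireOne f) (g : Y → ℝ) : IsBaireOne g := by
  obtain ⟨T, hT⟩ := h
  let φ : Y → Module.Dual ℝ (Cp X) := fun y => T.toLinearMap.dualMap (Cp.eval y)
  have hφ : LinearIndependent ℝ φ :=
    Cp.linearIndependent_eval.map' T.toLinearMap.dualMap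
      (LinearMap.ker_eq_bot.2 (LinearMap.dualMap_injective_of_surjective hT))
  -- Linear independence lets `ψ` take the arbitrary values `g y` at `φ y`; no continuity of `ψ` is
  -- needed.
  obtain ⟨ψ, hψ⟩ := LinearMap.dualMap_surjective_of_injective hφ
    (Finsupp.linearCombination ℝ g)
  have hψφ : ∀ y, ψ (φ y) = g y := fun y => by
    simpa using LinearMap.congr_fun hψ (Finsupp.single y 1)
  obtain ⟨u, huc, hu⟩ := hX fun x => ψ (Cp.eval x)
  let w : ℕ → Cp X := fun n => ⟨u n, huc n⟩
  have key : ∀ χ ∈ Submodule.span ℝ (Set.range (Cp.eval (X := X))),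
      Tendsto (fun n => χ (w n)) atTop (𝓝 (ψ χ)) := by
    intro χ hχ
    induction hχ using Submodule.span_induction with
    | mem χ hχ => obtain ⟨x, rfl⟩ := hχ; exact hu x
    | zero => simp
    | add χ₁ χ₂ _ _ h₁ h₂ => simpa using h₁.add h₂
    | smul c χ _ h => simpa using h.const_mul c
  refine ⟨fun n => T (w n), fun n => (T (w n)).2, fun y => ?_⟩
  rw [← hψφ y]
  exact key (φ y) (Cp.mem_span_eval ((Cp.continuous_eval y).comp T.continuous))

theorem LDominated.isQSpace [T4Space X] [T4Space Y] (h : LDominated Y X) (hX : IsQSpace X) :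
    IsQSpace Y :=
  .of_forall_isBaireOne (h.isBaireOne hX.isBaireOne)

end Dual

/-- The first part is about normal (Hausdorff) spaces, the second about metrizable spaces, the
third about sets of reals with the subspace topology. -/
theorem theorem3p4 :
    (∀ (X : Type u) (Y : Type v) [TopologicalSpace X] [TopologicalSpace Y] [T4Space X] [T4Space Y],
      LDominated Y X → IsQSpace X → IsQSpace Y) ∧
    (∀ (X : Type u) (Y : Type v) [TopologicalSpace X] [TopologicalSpace Y]
      [TopologicalSpace.MetrizableSpace X] [TopologicalSpace.MetrizableSpace Y],
      LDominated Y X → IsQSpace X → IsQSpace Y) ∧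
    (∀ A B : Set ℝ, LDominated B A → IsQSpace A → IsQSpace B) := by
  exact ⟨fun X Y _ _ _ _ h hX => h.isQSpace hX, fun X Y _ _ _ _ h hX => h.isQSpace hX,
    fun A B h hA => h.isQSpace hA⟩
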